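/- Let $K$ be a field and let $q\in K$ be nonzero and not a root of unity. Write $(x;q)_n=\prod_{i=0}^{n-1}(1-xq^i)$. For $a\neq 0$ with $aq^m\ne 1$ for all $m\ge 1$, sequences $\alpha_n(a,k)$, $\beta_n(a,k)$ $(n\ge 0)$ form a WP-Bailey pair with respect to $(a,k)$ if $$\beta_n(a,k)=\sum_{j=0}^n\frac{(k/a;q)_{n-j}(k;q)_{n+j}}{(q;q)_{n-j}(aq;q)_{n+j}}\,\alpha_j(a,k)\qquad\text{for all } n\ge 0 .$$ Let $\alpha_n(a,k)$ and $\beta_n(a,k)$ be families of elements of $K$ indexed by $n\ge 0$ and $a,k\in K$, and put $$\alpha_n'(a,k)=\frac{(a^2/k;q)_{2n}}{(kq;q)_{2n}}\left(\frac{k^2q}{a^2}\right)^n\alpha_n\!\left(a,\frac{a^2}{kq}\right),$$ $$\beta_n'(a,k)=\frac{1-k}{1-kq^{2n}}\sum_{j=0}^n\frac{1-\frac{a^2q^{2j}}{kq}}{1-\frac{a^2}{kq}}\,\frac{(k^2q/a^2;q)_{n-j}}{(q;q)_{n-j}}\left(\frac{k^2q}{a^2}\right)^j\beta_j\!\left(a,\frac{a^2}{kq}\right).$$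 Let $a,k\in K$ be nonzero with $aq^m\neq 1$ for all $m\ge 1$, $kq^m\ne 1$ for all $m\ge 0$, and $a^2\neq kq$ (so that all denominators are nonzero). (i) If $(\alpha_n(a,a^2/(kq)),\beta_n(a,a^2/(kq)))$ is a WP-Bailey pair with respect to $(a,a^2/(kq))$, then $(\alpha_n'(a,k),\beta_n'(a,k))$ is a WP-Bailey pair with respect to $(a,k)$. (ii) If moreover $\frac{a^2}{kq}q^m\neq 1$ for all $m\ge 0$ (so that the construction is also defined at $(a,a^2/(kq))$), then applying the construction twice returns the original sequences: $\alpha_n''(a,k)=\alpha_n(a,k)$ and $\beta_n''(a,k)=\beta_n(a,k)$ for all $n\ge 0$. -/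

import Mathlib

/-- The `q`-shifted factorial `(x; q)_n = ∏_{i < n} (1 - x q^i)`. -/
def qPoch {K : Type*} [Field K] (x q : K) (n : ℕ) : K :=
  ∏ i ∈ Finset.range n, (1 - x * q ^ i)

/-- The sequences `α_n = α_n(a,k,q)` and `β_n = β_n(a,k,q)` form a WP-Bailey pair with respect to
the parameters `a`, `k` and the base `q`:
`β_n = ∑_{j=0}^{n} (k/a;q)_{n-j} (k;q)_{n+j} / ((q;q)_{n-j} (aq;q)_{n+j}) α_j` for all `n`. -/
def IsWPBaileyPair {K : Type*} [Field K] (q a k : K) (α β : ℕ → K) : Prop :=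
  ∀ n : ℕ, β n = ∑ j ∈ Finset.range (n + 1),
    (qPoch (k / a) q (n - j) * qPoch k q (n + j)) /
      (qPoch q q (n - j) * qPoch (a * q) q (n + j)) * α j

/-- The new `α'`, built from a two-parameter family `α a k n`, standing for `α_n(a,k,q)`. -/
def chainAlpha {K : Type*} [Field K] (q : K) (α : K → K → ℕ → K) : K → K → ℕ → K :=
  fun a k n =>
    qPoch (a ^ 2 / k) q (2 * n) / qPoch (k * q) q (2 * n) * (k ^ 2 * q / a ^ 2) ^ n *
      α a (a ^ 2 / (k * q)) n

/-- The new `β'`, built from a two-parameter family `β a k n`, standing for `β_n(a,k,q)`. -/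
def chainBeta {K : Type*} [Field K] (q : K) (β : K → K → ℕ → K) : K → K → ℕ → K :=
  fun a k n =>
    (1 - k) / (1 - k * q ^ (2 * n)) * ∑ j ∈ Finset.range (n + 1),
      (1 - a ^ 2 * q ^ (2 * j) / (k * q)) / (1 - a ^ 2 / (k * q)) *
        (qPoch (k ^ 2 * q / a ^ 2) q (n - j) / qPoch q q (n - j)) *
        (k ^ 2 * q / a ^ 2) ^ j * β a (a ^ 2 / (k * q)) j

/-! Put `c = a²/(kq)` and `x = c/a`, so that `k = a/(xq)` and `k²q/a² = 1/(x²q)`. For (i), insert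
the WP-Bailey sum for `β_j` into `β'_n` and exchange summations: the claim becomes one identity for
the coefficient of each `α_r` (`chain_coeff`). Replacing `a` by `aq^{2r}` reduces it to
`sum_chain_kernel`, a combination of two consecutive `q`-Pfaff–Saalschütz sums. For (ii), `k ↦ c` is
an involution with `c²q/a² = (k²q/a²)⁻¹`, so the `α` prefactors cancel. The two `β` transforms are
mutually inverse triangular matrices by `sum_qPoch_inv`, again a case of Saalschütz. -/

section QPochhammer

variable {K : Type*} [Field K]

theorem qPoch_zero (x q : K) : qPoch x q 0 = 1 := by simp [qPoch]

theorem qPoch_succ (x q : K) (n : ℕ) : qPoch x q (n + 1) = qPoch x q n * (1 - x * q ^ n) := by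
  simp [qPoch, Finset.prod_range_succ]

theorem qPoch_add (x q : K) (m n : ℕ) :
    qPoch x q (m + n) = qPoch x q m * qPoch (x * q ^ m) q n := by
  simp only [qPoch, Finset.prod_range_add]
  congr 1
  exact Finset.prod_congr rfl fun i _ => by ring

theorem qPoch_succ' (x q : K) (n : ℕ) : qPoch x q (n + 1) = (1 - x) * qPoch (x * q) q n := by
  rw [add_comm, qPoch_add, qPoch_succ, qPoch_zero]
  simp

theorem qPoch_ne_zero {x q : K} (h : ∀ m : ℕ, x * q ^ m ≠ 1) (n : ℕ) : qPoch x q n ≠ 0 :=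
  Finset.prod_ne_zero_iff.2 fun i _ => sub_ne_zero.2 (h i).symm

theorem mul_pow_shift_ne_one {a q : K} (h : ∀ m : ℕ, 1 ≤ m → a * q ^ m ≠ 1) (m : ℕ) :
    a * q * q ^ m ≠ 1 := by
  have := h (m + 1) (by omega)
  rwa [pow_succ', ← mul_assoc] at this

theorem self_mul_pow_ne_one {q : K} (h : ∀ m : ℕ, 1 ≤ m → q ^ m ≠ 1) (m : ℕ) :
    q * q ^ m ≠ 1 := by
  simpa using mul_pow_shift_ne_one (a := (1 : K)) (by simpa using h) m

/-! ### The `q`-Pfaff–Saalschütz sum -/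

/-- The summand of the `q`-Pfaff–Saalschütz sum, with `b = w / (u v)`. -/
def saalTerm (q u v w : K) (n i : ℕ) : K :=
  qPoch u q i * qPoch v q i * qPoch (w / (u * v)) q (n - i) * (w / (u * v)) ^ i /
    (qPoch q q i * qPoch w q i * qPoch q q (n - i))

/-- The telescoping companion of `saalTerm`. -/
def saalCert (q u v w : K) (n i : ℕ) : K :=
  -(q ^ (n + 1) / q ^ i) * ((1 - q ^ i) * (1 - w / q * q ^ i)) *
    (qPoch u q i * qPoch v q i * qPoch (w / (u * v)) q (n + 1 - i) * (w / (u * v)) ^ i /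
      (qPoch q q i * qPoch w q i * qPoch q q (n + 1 - i)))

/-- A `q`-Zeilberger certificate: summed over `i`, it gives a first-order recurrence in `n` for the
Saalschütz sum. Writing the upper index as `i + d` avoids truncated subtraction. -/
theorem saalTerm_telescope {q u v w : K} (hq0 : q ≠ 0) (hu : u ≠ 0) (hv : v ≠ 0)
    (hq : ∀ m : ℕ, q * q ^ m ≠ 1) (hw : ∀ m : ℕ, w * q ^ m ≠ 1) (i d : ℕ) :
    (1 - q ^ (i + d + 1)) * (1 - w * q ^ (i + d)) * saalTerm q u v w (i + d + 1) i -
      (1 - w / u * q ^ (i + d)) * (1 - w / v * q ^ (i + d)) * saalTerm q u v w (i + d) i =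
    saalCert q u v w (i + d) (i + 1) - saalCert q u v w (i + d) i := by
  have e1 : i + d + 1 - i = d + 1 := by omega
  have e2 : i + d - i = d := by omega
  have e3 : i + d + 1 - (i + 1) = d := by omega
  have h1 := qPoch_ne_zero hq i
  have h2 := qPoch_ne_zero hw i
  have h3 := qPoch_ne_zero hq d
  have h4 : 1 - q * q ^ i ≠ 0 := sub_ne_zero.2 (hq i).symm
  have h5 : 1 - w * q ^ i ≠ 0 := sub_ne_zero.2 (hw i).symm
  have h6 : 1 - q * q ^ d ≠ 0 := sub_ne_zero.2 (hq d).symm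
  have h7 : q ^ i ≠ 0 := pow_ne_zero _ hq0
  simp only [saalTerm, saalCert, e1, e2, e3, qPoch_succ, pow_succ, pow_add]
  generalize qPoch q q i = a1 at *
  generalize qPoch w q i = a2 at *
  generalize qPoch q q d = a3 at *
  generalize qPoch u q i = a4 at *
  generalize qPoch v q i = a5 at *
  generalize qPoch (w / (u * v)) q d = a6 at *
  generalize hB : (w / (u * v)) ^ i = a7 at *
  generalize q ^ i = y at *
  generalize q ^ d = z at *
  generalize h4e : 1 - q * y = D4 at *
  generalize h5e : 1 - w * y = D5 at *
  generalize h6e : 1 - q * z = D6 at *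
  field_simp
  subst h4e h5e h6e
  ring

/-- The `q`-Pfaff–Saalschütz summation. -/
theorem sum_saalTerm {q u v w : K} (hq0 : q ≠ 0) (hu : u ≠ 0) (hv : v ≠ 0)
    (hq : ∀ m : ℕ, q * q ^ m ≠ 1) (hw : ∀ m : ℕ, w * q ^ m ≠ 1) (n : ℕ) :
    ∑ i ∈ Finset.range (n + 1), saalTerm q u v w n i =
      qPoch (w / u) q n * qPoch (w / v) q n / (qPoch q q n * qPoch w q n) := by
  induction n with
  | zero => simp [saalTerm, qPoch_zero]
  | succ n ih =>
    have h1 := qPoch_ne_zero hq n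
    have h2 := qPoch_ne_zero hw n
    have h4 : 1 - q * q ^ n ≠ 0 := sub_ne_zero.2 (hq n).symm
    have h5 : 1 - w * q ^ n ≠ 0 := sub_ne_zero.2 (hw n).symm
    have h7 : q ^ n ≠ 0 := pow_ne_zero _ hq0
    have tel : ∑ i ∈ Finset.range (n + 1),
        ((1 - q ^ (n + 1)) * (1 - w * q ^ n) * saalTerm q u v w (n + 1) i -
          (1 - w / u * q ^ n) * (1 - w / v * q ^ n) * saalTerm q u v w n i) =
        saalCert q u v w n (n + 1) - saalCert q u v w n 0 := by
      rw [← Finset.sum_range_sub]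
      refine Finset.sum_congr rfl fun i hi => ?_
      obtain ⟨d, rfl⟩ := Nat.exists_eq_add_of_le (Finset.mem_range_succ_iff.1 hi)
      exact saalTerm_telescope hq0 hu hv hq hw i d
    rw [Finset.sum_sub_distrib, ← Finset.mul_sum, ← Finset.mul_sum, ih] at tel
    -- Telescoping covers only `i ≤ n`; the extra term `i = n + 1` of the longer sum cancels the
    -- upper boundary value.
    have top : (1 - q ^ (n + 1)) * (1 - w * q ^ n) * saalTerm q u v w (n + 1) (n + 1) +
        saalCert q u v w n (n + 1) = 0 := by
      simp only [saalTerm, saalCert, Nat.sub_self, qPoch_zero, pow_succ]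
      field_simp
      ring
    have bot : saalCert q u v w n 0 = 0 := by simp [saalCert]
    have key : (1 - q ^ (n + 1)) * (1 - w * q ^ n) *
        ∑ i ∈ Finset.range (n + 1 + 1), saalTerm q u v w (n + 1) i =
        (1 - w / u * q ^ n) * (1 - w / v * q ^ n) *
          (qPoch (w / u) q n * qPoch (w / v) q n / (qPoch q q n * qPoch w q n)) := by
      rw [Finset.sum_range_succ]
      linear_combination tel + top - bot
    rw [pow_succ'] at key
    rw [← mul_right_inj' (mul_ne_zero h4 h5), key]
    simp only [qPoch_succ]
    generalize 1 - q * q ^ n = D4 at *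
    field_simp

/-- Orthogonality of the inverse pair of lower triangular matrices with parameter `p`. -/
theorem sum_qPoch_inv {q p : K} (hq0 : q ≠ 0) (hp : p ≠ 0)
    (hq : ∀ m : ℕ, q * q ^ m ≠ 1) (n : ℕ) :
    ∑ i ∈ Finset.range (n + 1),
      qPoch p q (n - i) / qPoch q q (n - i) * (qPoch p⁻¹ q i / qPoch q q i) * p ^ i =
      if n = 0 then 1 else 0 := by
  -- With `v = w = q` the closed form contains `(1;q)_n`, which vanishes for `n > 0`.
  have h := sum_saalTerm hq0 (inv_ne_zero hp) hq0 hq hq n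
  have e : q / (p⁻¹ * q) = p := by field_simp
  rw [div_self hq0] at h
  trans ∑ i ∈ Finset.range (n + 1), saalTerm q p⁻¹ q q n i
  · refine Finset.sum_congr rfl fun i _ => ?_
    have h1 := qPoch_ne_zero hq i
    have h2 := qPoch_ne_zero hq (n - i)
    rw [saalTerm, e]
    field_simp
  · rw [h]
    cases n with
    | zero => simp [qPoch_zero]
    | succ n => simp [qPoch_succ' (1 : K)]

/-! ### Coefficients of the new pair -/

/-- The summation behind the change of parameter `c = x a ↦ k = a / (x q)`. -/
theorem sum_chain_kernel {q A x : K} (hq0 : q ≠ 0) (hA0 : A ≠ 0) (hx : x ≠ 0)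
    (hq : ∀ m : ℕ, q * q ^ m ≠ 1) (hA : ∀ m : ℕ, A * q * q ^ m ≠ 1) (n : ℕ) :
    (1 - A / (x * q)) * ∑ i ∈ Finset.range (n + 1), (1 - x * A * q ^ (2 * i)) *
      (qPoch (1 / (x ^ 2 * q)) q (n - i) / qPoch q q (n - i)) * (1 / (x ^ 2 * q)) ^ i *
      (qPoch x q i * qPoch (x * A) q i / (qPoch q q i * qPoch (A * q) q i)) =
    (1 - x * A) * (1 - A / (x * q) * q ^ (2 * n)) *
      (qPoch (1 / (x * q)) q n * qPoch (A / (x * q)) q n) /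
      (qPoch q q n * qPoch (A * q) q n) := by
  have hxA : x * A * q ≠ 0 := by positivity
  have hxq : x * q ≠ 0 := mul_ne_zero hx hq0
  have e : A * q / (x * A * q * (x * q)) = 1 / (x ^ 2 * q) := by field_simp
  have hs := sum_saalTerm hq0 hxA hxq hq hA
  cases n with
  | zero => simp [qPoch_zero]; ring
  | succ n =>
    -- Term `i + 1` of the first sum pairs with term `i` of the second. With `Q = q^{i+1}`, the
    -- split is `(1 - xAQ)(1 - xQ) - x(1 - Q)(1 - AQ) = (1 - x)(1 - xAQ²)`.
    have hsum : ∑ i ∈ Finset.range (n + 1 + 1), (1 - x * A * q ^ (2 * i)) *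
      (qPoch (1 / (x ^ 2 * q)) q (n + 1 - i) / qPoch q q (n + 1 - i)) * (1 / (x ^ 2 * q)) ^ i *
      (qPoch x q i * qPoch (x * A) q i / (qPoch q q i * qPoch (A * q) q i)) =
      (1 - x * A) * (∑ i ∈ Finset.range (n + 1 + 1),
          saalTerm q (x * A * q) (x * q) (A * q) (n + 1) i -
        1 / (x * q) * ∑ i ∈ Finset.range (n + 1),
          saalTerm q (x * A * q) (x * q) (A * q) n i) := by
      rw [Finset.sum_range_succ', Finset.sum_range_succ' _ (n + 1), add_sub_right_comm,
        Finset.mul_sum, ← Finset.sum_sub_distrib, mul_add, Finset.mul_sum]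
      congr 1
      · refine Finset.sum_congr rfl fun i _ => ?_
        have h1 := qPoch_ne_zero hq i
        have h2 := qPoch_ne_zero hA i
        have h3 := qPoch_ne_zero hq (n - i)
        have h4 : 1 - q * q ^ i ≠ 0 := sub_ne_zero.2 (hq i).symm
        have h5 : 1 - A * q * q ^ i ≠ 0 := sub_ne_zero.2 (hA i).symm
        simp only [saalTerm, e, Nat.add_sub_add_right]
        rw [qPoch_succ' x, qPoch_succ' (x * A), qPoch_succ q, qPoch_succ (A * q),
          qPoch_succ (x * A * q), qPoch_succ (x * q), mul_add, pow_add, pow_mul']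
        generalize qPoch (1 / (x ^ 2 * q)) q (n - i) = a6 at *
        simp only [pow_succ (1 / (x ^ 2 * q))]
        generalize (1 / (x ^ 2 * q)) ^ i = a7 at *
        generalize h4e : 1 - q * q ^ i = D4 at *
        generalize h5e : 1 - A * q * q ^ i = D5 at *
        field_simp
        subst h4e h5e
        ring
      · simp [saalTerm, qPoch_zero, e]
    have h1 := qPoch_ne_zero hq n
    have h2 := qPoch_ne_zero hA n
    have h4 : 1 - q * q ^ n ≠ 0 := sub_ne_zero.2 (hq n).symm
    have h5 : 1 - A * q * q ^ n ≠ 0 := sub_ne_zero.2 (hA n).symm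
    have e1 : A * q / (x * A * q) = 1 / x := by field_simp
    have e2 : A * q / (x * q) = A / x := by field_simp
    have e3 : 1 / (x * q) * q = 1 / x := by field_simp
    have e4 : A / (x * q) * q = A / x := by field_simp
    rw [hsum, hs, hs, e1, e2, qPoch_succ' (1 / (x * q)), qPoch_succ' (A / (x * q)), e3, e4]
    simp only [qPoch_succ]
    generalize qPoch (1 / x) q n = b1
    generalize qPoch (A / x) q n = b2
    rw [mul_add, pow_add, pow_mul']
    generalize h4e : 1 - q * q ^ n = D4 at *
    generalize h5e : 1 - A * q * q ^ n = D5 at *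
    field_simp
    subst h4e h5e
    ring

theorem sum_range_triangle (f : ℕ → ℕ → K) (n : ℕ) :
    ∑ j ∈ Finset.range (n + 1), ∑ r ∈ Finset.range (j + 1), f j r =
      ∑ r ∈ Finset.range (n + 1), ∑ i ∈ Finset.range (n - r + 1), f (r + i) r := by
  trans ∑ r ∈ Finset.range (n + 1), ∑ i ∈ Finset.range (n + 1 - r), f (r + i) r
  · rw [← Finset.sum_range_diag_flip]
    refine Finset.sum_congr rfl fun j _ => Finset.sum_congr rfl fun r hr => ?_
    rw [Nat.add_sub_cancel' (Finset.mem_range_succ_iff.1 hr)]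
  · refine Finset.sum_congr rfl fun r hr => ?_
    rw [Nat.sub_add_comm (Finset.mem_range_succ_iff.1 hr)]

/-- The coefficient of `α_r` in `β'_{r + n}`. -/
theorem chain_coeff {q a x k : K} (hq0 : q ≠ 0) (ha0 : a ≠ 0) (hx : x ≠ 0)
    (hkx : k = a / (x * q)) (hq : ∀ m : ℕ, q * q ^ m ≠ 1) (ha : ∀ m : ℕ, a * q * q ^ m ≠ 1)
    (hk : ∀ m : ℕ, k * q ^ m ≠ 1) (hc : x * a ≠ 1) (r n : ℕ) :
    (1 - k) / (1 - k * q ^ (2 * (r + n))) * ∑ i ∈ Finset.range (n + 1),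
      (1 - x * a * q ^ (2 * (r + i))) / (1 - x * a) *
        (qPoch (1 / (x ^ 2 * q)) q (n - i) / qPoch q q (n - i)) * (1 / (x ^ 2 * q)) ^ (r + i) *
        (qPoch x q i * qPoch (x * a) q (2 * r + i) /
          (qPoch q q i * qPoch (a * q) q (2 * r + i))) =
    qPoch (1 / (x * q)) q n * qPoch k q (2 * r + n) /
      (qPoch q q n * qPoch (a * q) q (2 * r + n)) *
      (qPoch (x * a * q) q (2 * r) / qPoch (k * q) q (2 * r) * (1 / (x ^ 2 * q)) ^ r) := by
  have hA : ∀ m : ℕ, a * q ^ (2 * r) * q * q ^ m ≠ 1 := fun m => by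
    have := ha (2 * r + m)
    rwa [pow_add, ← mul_assoc, mul_right_comm a] at this
  have hker := sum_chain_kernel hq0 (mul_ne_zero ha0 (pow_ne_zero (2 * r) hq0)) hx hq hA n
  have ek : a * q ^ (2 * r) / (x * q) = k * q ^ (2 * r) := by rw [hkx]; ring
  have ec : x * (a * q ^ (2 * r)) = x * a * q ^ (2 * r) := by ring
  have ea : a * q * q ^ (2 * r) = a * q ^ (2 * r) * q := by ring
  rw [ek, ec] at hker
  have hcs : qPoch (x * a) q (2 * r) * (1 - x * a * q ^ (2 * r)) =
      (1 - x * a) * qPoch (x * a * q) q (2 * r) := by rw [← qPoch_succ, qPoch_succ']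
  have hks : qPoch k q (2 * r) * (1 - k * q ^ (2 * r)) =
      (1 - k) * qPoch (k * q) q (2 * r) := by rw [← qPoch_succ, qPoch_succ']
  have n1 : 1 - k * q ^ (2 * r) ≠ 0 := sub_ne_zero.2 (hk _).symm
  have n2 : 1 - k * q ^ (2 * (r + n)) ≠ 0 := sub_ne_zero.2 (hk _).symm
  have n3 : 1 - x * a ≠ 0 := sub_ne_zero.2 hc.symm
  have n4 := qPoch_ne_zero hq n
  have n5 := qPoch_ne_zero ha (2 * r)
  have n6 := qPoch_ne_zero hA n
  have n7 : qPoch (k * q) q (2 * r) ≠ 0 :=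
    qPoch_ne_zero (mul_pow_shift_ne_one fun m _ => hk m) _
  -- Splitting `(y;q)_{2r+i} = (y;q)_{2r} (yq^{2r};q)_i` isolates the kernel at `A = aq^{2r}`.
  have pull : ∀ i ∈ Finset.range (n + 1), (1 - x * a * q ^ (2 * (r + i))) / (1 - x * a) *
        (qPoch (1 / (x ^ 2 * q)) q (n - i) / qPoch q q (n - i)) * (1 / (x ^ 2 * q)) ^ (r + i) *
        (qPoch x q i * qPoch (x * a) q (2 * r + i) /
          (qPoch q q i * qPoch (a * q) q (2 * r + i))) =
      (1 / (x ^ 2 * q)) ^ r * qPoch (x * a) q (2 * r) / ((1 - x * a) * qPoch (a * q) q (2 * r)) *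
      ((1 - x * a * q ^ (2 * r) * q ^ (2 * i)) *
      (qPoch (1 / (x ^ 2 * q)) q (n - i) / qPoch q q (n - i)) * (1 / (x ^ 2 * q)) ^ i *
      (qPoch x q i * qPoch (x * a * q ^ (2 * r)) q i /
        (qPoch q q i * qPoch (a * q ^ (2 * r) * q) q i))) := fun i _ => by
    rw [qPoch_add, qPoch_add, ea, pow_add, mul_add, pow_add q]
    have n8 := qPoch_ne_zero hq i
    have n9 := qPoch_ne_zero hA i
    have n10 := qPoch_ne_zero hq (n - i)
    generalize (1 / (x ^ 2 * q)) ^ i = z1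
    generalize (1 / (x ^ 2 * q)) ^ r = z2
    field_simp
  rw [Finset.sum_congr rfl pull, ← Finset.mul_sum]
  rw [mul_comm, ← eq_div_iff n1] at hker
  rw [hker, qPoch_add k, qPoch_add (a * q), ea]
  have e2 : k * q ^ (2 * r) * q ^ (2 * n) = k * q ^ (2 * (r + n)) := by ring
  rw [e2]
  generalize (1 / (x ^ 2 * q)) ^ r = z2
  generalize 1 - k * q ^ (2 * (r + n)) = z3 at *
  generalize 1 - k * q ^ (2 * r) = z4 at *
  generalize 1 - x * a * q ^ (2 * r) = z5 at *
  generalize 1 - x * a = z6 at *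
  generalize qPoch (k * q ^ (2 * r)) q n = z7 at *
  generalize qPoch (1 / (x * q)) q n = z8 at *
  have hk' : qPoch k q (2 * r) = (1 - k) * qPoch (k * q) q (2 * r) / z4 := by
    rw [eq_div_iff n1, hks]
  rw [hk']
  generalize qPoch (a * q ^ (2 * r) * q) q n = z9 at *
  generalize qPoch (k * q) q (2 * r) = z10 at *
  field_simp
  linear_combination ((1 - k) * z2 * z7 * z8) * hcs

end QPochhammer


/-! ### The new pair and the involution -/

theorem mainTheorem3 {K : Type*} [Field K] (q a k : K)
    (hq0 : q ≠ 0) (ha0 : a ≠ 0) (hk0 : k ≠ 0)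
    (hq : ∀ m : ℕ, 1 ≤ m → q ^ m ≠ 1)
    (ha : ∀ m : ℕ, 1 ≤ m → a * q ^ m ≠ 1)
    (hk : ∀ m : ℕ, k * q ^ m ≠ 1)
    (hc : a ^ 2 / (k * q) ≠ 1)
    (α β : K → K → ℕ → K) :
    (IsWPBaileyPair q a (a ^ 2 / (k * q)) (α a (a ^ 2 / (k * q))) (β a (a ^ 2 / (k * q))) →
      IsWPBaileyPair q a k (chainAlpha q α a k) (chainBeta q β a k)) ∧
    ((∀ m : ℕ, a ^ 2 / (k * q) * q ^ m ≠ 1) →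
      chainAlpha q (chainAlpha q α) a k = α a k ∧
      chainBeta q (chainBeta q β) a k = β a k) := by
  have hq' := self_mul_pow_ne_one hq
  have hkq : k * q ≠ 0 := mul_ne_zero hk0 hq0
  refine ⟨fun h n => ?_, fun hcm => ?_⟩
  · obtain ⟨x, hx, rfl⟩ : ∃ x : K, x ≠ 0 ∧ k = a / (x * q) :=
      ⟨a / (k * q), div_ne_zero ha0 hkq, by field_simp⟩
    have ec : a ^ 2 / (a / (x * q) * q) = x * a := by field_simp
    have ec' : ∀ z, a ^ 2 * z / (a / (x * q) * q) = x * a * z := fun z => by field_simp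
    have ep : (a / (x * q)) ^ 2 * q / a ^ 2 = 1 / (x ^ 2 * q) := by field_simp
    have ex : x * a / a = x := by field_simp
    have e1 : a ^ 2 / (a / (x * q)) = x * a * q := by field_simp
    have e2 : a / (x * q) / a = 1 / (x * q) := by field_simp
    rw [ec] at h hc
    simp only [chainBeta, chainAlpha, ec, ec', ep, e1, e2]
    rw [Finset.sum_congr rfl fun j _ => by rw [h j, Finset.mul_sum], sum_range_triangle,
      Finset.mul_sum]
    refine Finset.sum_congr rfl fun r hr => ?_
    obtain ⟨N, rfl⟩ := Nat.exists_eq_add_of_le (Finset.mem_range_succ_iff.1 hr)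
    have key := chain_coeff hq0 ha0 hx rfl hq' (mul_pow_shift_ne_one ha) hk hc r N
    rw [show r + N + r = 2 * r + N by ring, Nat.add_sub_cancel_left, ← mul_assoc _ _ (α _ _ _),
      ← key, mul_assoc, Finset.sum_mul]
    congr 1
    refine Finset.sum_congr rfl fun i _ => ?_
    rw [show r + i + r = 2 * r + i by ring, Nat.add_sub_cancel_left, Nat.add_sub_add_left, ex]
    ring
  · obtain ⟨c, hcd⟩ : ∃ c, c = a ^ 2 / (k * q) := ⟨_, rfl⟩
    rw [← hcd] at hcm
    have hc0 : c ≠ 0 := hcd ▸ div_ne_zero (pow_ne_zero _ ha0) hkq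
    have ek : a ^ 2 / (c * q) = k := by rw [hcd]; field_simp
    have ek' : ∀ z, a ^ 2 * z / (c * q) = k * z := fun z => by rw [hcd]; field_simp
    have ec' : ∀ z, a ^ 2 * z / (k * q) = c * z := fun z => by rw [hcd]; field_simp
    have e1 : a ^ 2 / k = c * q := by rw [hcd]; field_simp
    have e2 : a ^ 2 / c = k * q := by rw [hcd]; field_simp
    have e3 : k ^ 2 * q / a ^ 2 = k / c := by rw [hcd]; field_simp
    have e4 : c ^ 2 * q / a ^ 2 = (k / c)⁻¹ := by rw [hcd]; field_simp
    have hp : k / c ≠ 0 := div_ne_zero hk0 hc0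
    constructor
    · funext n
      simp only [chainAlpha, ← hcd, ek, e1, e2, e3, e4]
      have n1 : qPoch (k * q) q (2 * n) ≠ 0 :=
        qPoch_ne_zero (mul_pow_shift_ne_one fun m _ => hk m) _
      have n2 : qPoch (c * q) q (2 * n) ≠ 0 :=
        qPoch_ne_zero (mul_pow_shift_ne_one fun m _ => hcm m) _
      rw [inv_pow]
      have n3 := pow_ne_zero n hp
      generalize (k / c) ^ n = z at *
      generalize qPoch (k * q) q (2 * n) = z1 at *
      field_simp
    · funext n
      simp only [chainBeta, ← hcd, ek, ek', ec', e3, e4]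
      have nk : ∀ m, 1 - k * q ^ m ≠ 0 := fun m => sub_ne_zero.2 (hk m).symm
      have nc : ∀ m, 1 - c * q ^ m ≠ 0 := fun m => sub_ne_zero.2 (hcm m).symm
      have nk0 : 1 - k ≠ 0 := by simpa using nk 0
      have nc0 : 1 - c ≠ 0 := by simpa using nc 0
      simp only [Finset.mul_sum]
      rw [sum_range_triangle, Finset.sum_eq_single_of_mem n (Finset.self_mem_range_succ n)]
      · have nkn := nk (2 * n)
        have ncn := nc (2 * n)
        have n3 := pow_ne_zero n hp
        simp only [Nat.sub_self, zero_add, Finset.sum_range_one, add_zero, qPoch_zero, inv_pow]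
        generalize (k / c) ^ n = z at *
        generalize 1 - k * q ^ (2 * n) = z1 at *
        generalize 1 - c * q ^ (2 * n) = z2 at *
        field_simp
      · intro r hr hrn
        obtain ⟨N, rfl⟩ := Nat.exists_eq_add_of_le (Finset.mem_range_succ_iff.1 hr)
        have hN : N ≠ 0 := by omega
        have orth := sum_qPoch_inv hq0 hp hq' N
        rw [if_neg hN] at orth
        rw [Nat.add_sub_cancel_left]
        -- The factors in `1 - cq^{2j}` cancel inside the sum, and those in `k` depend only on the
        -- endpoints `r` and `r + N`; orthogonality remains.
        trans (1 - k * q ^ (2 * r)) / (1 - k * q ^ (2 * (r + N))) * β a k r *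
          ∑ i ∈ Finset.range (N + 1), qPoch (k / c) q (N - i) / qPoch q q (N - i) *
            (qPoch (k / c)⁻¹ q i / qPoch q q i) * (k / c) ^ i
        · rw [Finset.mul_sum]
          refine Finset.sum_congr rfl fun i _ => ?_
          have n1 := nk (2 * (r + N))
          have n2 := nc (2 * (r + i))
          have n3 := pow_ne_zero r hp
          have n4 := qPoch_ne_zero hq' i
          have n5 := qPoch_ne_zero hq' (N - i)
          rw [Nat.add_sub_cancel_left, Nat.add_sub_add_left, pow_add, inv_pow]
          generalize (k / c) ^ r = z at *
          generalize (k / c) ^ i = z3 at *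
          generalize 1 - k * q ^ (2 * (r + N)) = z1 at *
          generalize 1 - c * q ^ (2 * (r + i)) = z2 at *
          field_simp
        · rw [orth, mul_zero]
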